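/- Let $H\neq\{0\}$ be a complex Hilbert space and let $A:H\to H$ be a bounded antilinear operator ($A(x+y)=Ax+Ay$ and $A(cx)=\overline{c}\,Ax$ for $x,y\in H$, $c\in\mathbb C$) which is self-adjoint, i.e. $\operatorname{Re}(Ax,y)=\operatorname{Re}(x,Ay)$ for all $x,y\in H$. Suppose that $A$ has a cyclic vector, i.e. there is $x\in H$ such that the set of all vectors $\sum_{k=0}^{n}\alpha_k A^k x$ ($n\ge 0$, $\alpha_k\in\mathbb C$) is dense in $H$. Then there exist a compactly supported symmetric biradial measure $\mu$ on $\mathbb C$ and a $\mathbb C$-linear isometric isomorphism $U:H\to L^2(\mu)$ (onto $L^2(\mu)$) such that for every $f\in L^2(\mu)$ $$(UAU^{-1}f)(\lambda)=\lambda\,\overline{f(\lambda)}\qquad\text{for }\mu\text{-almost every }\lambda\in\mathbb C .$$ Here a Borel measure $\mu$ on $\mathbb C$ is called biradial if there are positive Borel measures $\rho_1^+,\rho_2^+$ on $[0,\infty)$ with $\rho_1^+([0,\infty))+\rho_2^+([0,\infty))=1$ and Borel measurable functions $\phi_1,\phi_2:[0,\infty)\to\mathbb R$ such that, for every Borel set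 $E\subset\mathbb C$, $$\mu(E)=\sum_{j=1}^{2}\rho_j^+\bigl(\{r\ge 0 : r e^{i\phi_j(r)}\in E\}\bigr).$$ It is called symmetric if these can be chosen such that $\phi_1(r)=\phi_2(r)+\pi$ modulo $2\pi$ for every $r\ge 0$. -/

import Mathlib

open MeasureTheory
open scoped NNReal ComplexConjugate Polynomial

noncomputable section

namespace Antilinear

section Operators

variable {H : Type*} [NormedAddCommGroup H] [InnerProductSpace ℂ H]

/-- Self-adjointness of a bounded antilinear operator `A`, viewed as a real linear operator: `A`
equals its adjoint with respect to the real inner product `Re (x, y)`. -/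
def IsSelfAdjointOp (A : H →L⋆[ℂ] H) : Prop :=
  ∀ x y : H, (inner ℂ (A x) y).re = (inner ℂ x (A y)).re

/-- The vector `p(A) x = ∑ₖ αₖ Aᵏ x` for a polynomial `p = ∑ₖ αₖ Xᵏ` with complex coefficients. -/
def polyApply (A : H →L⋆[ℂ] H) (p : ℂ[X]) (x : H) : H :=
  ∑ k ∈ Finset.range (p.natDegree + 1), p.coeff k • (⇑A)^[k] x

/-- The closed invariant subspace `K(A; x)`: the closure of `{p(A) x : p a polynomial}`. -/
def krylov (A : H →L⋆[ℂ] H) (x : H) : Set H :=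
  closure {y : H | ∃ p : ℂ[X], y = polyApply A p x}

/-- The vector `x` is cyclic for `A` if `K(A; x) = H`. -/
def IsCyclicVector (A : H →L⋆[ℂ] H) (x : H) : Prop :=
  krylov A x = Set.univ

end Operators

section Measures

/-- The transformation `R_φ(z) = exp(-i φ(|z|)) z` of the plane. -/
def rotation (φ : ℝ≥0 → ℝ) (z : ℂ) : ℂ :=
  Complex.exp (-(Complex.I * (φ ‖z‖₊ : ℂ))) * z

/-- The measure on `ℂ` obtained by transporting a measure `ν` on `[0, ∞)` along the map
`r ↦ r exp(i φ(r))`. For measurable `φ` it is the measure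
`E ↦ ν (R_φ(E) ∩ [0, ∞))`, see `planeMeasure_apply`. -/
def planeMeasure (ν : Measure ℝ≥0) (φ : ℝ≥0 → ℝ) : Measure ℂ :=
  ν.map fun r : ℝ≥0 => (r : ℂ) * Complex.exp (Complex.I * (φ r : ℂ))

theorem measurable_radialCurve {φ : ℝ≥0 → ℝ} (hφ : Measurable φ) :
    Measurable fun r : ℝ≥0 => (r : ℂ) * Complex.exp (Complex.I * (φ r : ℂ)) := by
  have h1 : Measurable fun r : ℝ≥0 => ((r : ℝ) : ℂ) :=
    Complex.measurable_ofReal.comp measurable_subtype_coe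
  have h2 : Measurable fun r : ℝ≥0 => (φ r : ℂ) := Complex.measurable_ofReal.comp hφ
  exact h1.mul (Complex.measurable_exp.comp (measurable_const.mul h2))

theorem planeMeasure_apply (ν : Measure ℝ≥0) {φ : ℝ≥0 → ℝ} (hφ : Measurable φ) {E : Set ℂ}
    (hE : MeasurableSet E) :
    planeMeasure ν φ E = ν {r : ℝ≥0 | (r : ℂ) ∈ rotation φ '' E} := by
  rw [planeMeasure, Measure.map_apply (measurable_radialCurve hφ) hE]
  congr 1
  ext r
  simp only [Set.mem_preimage, Set.mem_setOf_eq, Set.mem_image]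
  have key : ∀ t : ℝ, ‖Complex.exp (Complex.I * (t : ℂ))‖₊ = 1 := fun t => by
    ext
    rw [mul_comm]
    simp [Complex.norm_exp_ofReal_mul_I]
  have hr : ‖(r : ℂ)‖₊ = r := by
    ext
    simp
  constructor
  · intro h
    refine ⟨_, h, ?_⟩
    have hn : ‖(r : ℂ) * Complex.exp (Complex.I * (φ r : ℂ))‖₊ = r := by
      rw [nnnorm_mul, key, hr, mul_one]
    rw [rotation, hn, mul_left_comm, ← Complex.exp_add]
    simp
  · rintro ⟨z, hz, hzr⟩
    have hn : ‖z‖₊ = r := by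
      have h := congrArg (fun w : ℂ => ‖w‖₊) hzr
      have h3 := key (-(φ ‖z‖₊))
      rw [Complex.ofReal_neg, mul_neg] at h3
      simp only [rotation, nnnorm_mul, hr] at h
      rwa [h3, one_mul] at h
    have : (r : ℂ) * Complex.exp (Complex.I * (φ r : ℂ)) = z := by
      rw [← hzr, rotation, hn, mul_right_comm, ← Complex.exp_add]
      simp
    rwa [this]

/-- The measure `μ` on `ℂ` is the biradial measure built from the measures `ν₁`, `ν₂` on `[0, ∞)`
of total mass `1` and the real-valued Borel functions `φ₁`, `φ₂` on `[0, ∞)`. -/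
structure IsBiradialOf (μ : Measure ℂ) (ν₁ ν₂ : Measure ℝ≥0) (φ₁ φ₂ : ℝ≥0 → ℝ) : Prop where
  measurable_left : Measurable φ₁
  measurable_right : Measurable φ₂
  mass_eq_one : ν₁ Set.univ + ν₂ Set.univ = 1
  eq_add : μ = planeMeasure ν₁ φ₁ + planeMeasure ν₂ φ₂

/-- A biradial measure is symmetric if `φ₁(r) = φ₂(r) + π` modulo `2π`. -/
def IsSymmetricBiradial (μ : Measure ℂ) : Prop :=
  ∃ (ν₁ ν₂ : Measure ℝ≥0) (φ₁ φ₂ : ℝ≥0 → ℝ), IsBiradialOf μ ν₁ ν₂ φ₁ φ₂ ∧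
    ∀ r : ℝ≥0, ∃ k : ℤ, φ₁ r = φ₂ r + Real.pi + 2 * Real.pi * k

end Measures

end Antilinear

end

/-!
# Self-adjoint antilinear operators with a cyclic vector

The square `T = A²` is a positive `ℂ`-linear operator, and `A p(T) = p̄(T) A` for every polynomial
`p`. A unit cyclic vector `x` therefore makes the vectors `p(T) x + q(T) A x` dense in `H`, and the
whole structure is contained in their Gram matrix. It is described by two objects on `[0, ∞)`, with
`r` standing for `|A|`:

* a probability measure `ρ` with `⟪x, p(T) x⟫ = ∫ p(r²) dρ` (`exists_moment_measure`, by the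
  continuous functional calculus and the Riesz–Markov–Kakutani theorem);
* a measurable function `s` with `⟪A x, p(T) x⟫ = ∫ s̄ p(r²) dρ` and `|s| ≤ r` almost everywhere
  (`exists_cross_density`).

Conjugating `f ↦ λ f̄` by a unimodular function `u` changes the factor `λ` into `u² λ`, so the
angles of the curves carrying `μ` are at our disposal, and `μ` can be placed on the real line.
With `w = |s| / r ∈ [0, 1]`, let `μ` have density `(1 + w) / 2` with respect to `ρ` on the positive
half-line and `(1 - w) / 2` on the negative one. Write `s = u² |s|` with `|u| = 1`; then
`p(T) x + q(T) A x ↦ ū(|z|) p(|z|²) + z u(|z|) q(|z|²)` preserves inner products: the diagonal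
terms only see the image `ρ` of `μ` under `z ↦ |z|`, and in the cross term the odd function `z`
integrates to `w r u² = s` (`inner_orbitMap_self`, `inner_phasedPolyLp_self`). Its range is dense by
the Stone–Weierstrass theorem (`denseRange_phasedPolyLp`), so it extends to a unitary, and it carries
`A` to `f ↦ z f̄` by a one-line computation (`apply_orbitMap`, `phasedPoly_conj`).
-/

noncomputable section

namespace Antilinear

/-! ### Moments of a positive operator and density of polynomials -/

/-- The spectral measure of `√T` at the vector `x`, characterised by its even moments. -/
theorem exists_moment_measure {H : Type*} [NormedAddCommGroup H] [InnerProductSpace ℂ H]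
    [CompleteSpace H] (T : H →L[ℂ] H) (hT : T.IsPositive) (x : H) :
    ∃ (ρ : Measure ℝ≥0) (M : ℝ≥0), IsFiniteMeasure ρ ∧ (∀ᵐ r ∂ρ, r ≤ M) ∧
      ∀ n : ℕ, inner ℂ x ((T ^ n) x) = ((∫ r : ℝ≥0, (r : ℝ) ^ (2 * n) ∂ρ : ℝ) : ℂ) := by
  have hTs : IsSelfAdjoint T := hT.isSelfAdjoint
  let X := spectrum ℝ T
  let Φ : C(X, ℝ) →⋆ₐ[ℝ] (H →L[ℂ] H) := cfcHom hTs
  have hpos : ∀ f : C(X, ℝ), 0 ≤ f → 0 ≤ (inner ℂ x (Φ f x)).re := by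
    intro f hf
    have h0 : (0 : H →L[ℂ] H) ≤ Φ f := (cfcHom_nonneg_iff hTs).2 hf
    exact ((ContinuousLinearMap.nonneg_iff_isPositive _).1 h0).re_inner_nonneg_right x
  let Λ₀ : CompactlySupportedContinuousMap X ℝ →ₗ[ℝ] ℝ :=
    { toFun := fun f => (inner ℂ x (Φ f.toContinuousMap x)).re
      map_add' := fun f g => by
        have : (f + g).toContinuousMap = f.toContinuousMap + g.toContinuousMap := rfl
        rw [this, map_add]
        simp
      map_smul' := fun c f => by
        have : (c • f).toContinuousMap = c • f.toContinuousMap := rfl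
        rw [this, map_smul, smul_apply, ← Complex.coe_smul, inner_smul_right]
        simp }
  let Λ : CompactlySupportedContinuousMap X ℝ →ₚ[ℝ] ℝ := PositiveLinearMap.mk₀ Λ₀ fun f hf =>
    hpos _ hf
  let ν := RealRMK.rieszMeasure Λ
  have hν : IsFiniteMeasure ν := inferInstance
  have hint : ∀ f : C(X, ℝ), ∫ t, f t ∂ν = (inner ℂ x (Φ f x)).re := fun f =>
    RealRMK.integral_rieszMeasure Λ ⟨f, HasCompactSupport.of_compactSpace f⟩
  have hX0 : ∀ t : X, 0 ≤ (t : ℝ) := fun t =>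
    spectrum_nonneg_of_nonneg ((ContinuousLinearMap.nonneg_iff_isPositive _).2 hT) t.2
  let j : X → ℝ≥0 := fun t => Real.toNNReal (Real.sqrt t)
  have hj : Continuous j := by fun_prop
  obtain ⟨M, hM⟩ := (isCompact_range hj).bddAbove
  refine ⟨ν.map j, M, inferInstance, ?_, ?_⟩
  · rw [ae_map_iff hj.aemeasurable measurableSet_Iic]
    exact .of_forall fun t => hM ⟨t, rfl⟩
  · intro n
    have h1 : ∫ r : ℝ≥0, (r : ℝ) ^ (2 * n) ∂(ν.map j) = (inner ℂ x ((T ^ n) x)).re := by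
      rw [integral_map hj.aemeasurable (by fun_prop)]
      have hid : Φ ((ContinuousMap.id ℝ).restrict X ^ n) = T ^ n := by
        rw [map_pow]
        congr 1
        exact cfcHom_id hTs
      rw [← hid, ← hint]
      refine integral_congr_ae (.of_forall fun t => ?_)
      have : ((j t : ℝ≥0) : ℝ) = Real.sqrt t := Real.coe_toNNReal _ (Real.sqrt_nonneg _)
      simp [this, pow_mul, Real.sq_sqrt (hX0 t)]
    rw [h1]
    have hs : IsSelfAdjoint (T ^ n) := hTs.pow n
    exact (hs.isSymmetric.coe_re_inner_self_apply x).symm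

/-- If `v` is injective on a compact set carrying `ν`, then the powers of `v` span a dense subspace
of `L²(ν)`. -/
theorem eq_top_of_pow_mem {Y : Type*} [TopologicalSpace Y] [NormalSpace Y] [MeasurableSpace Y]
    [BorelSpace Y] (ν : Measure Y) [IsFiniteMeasure ν] [ν.WeaklyRegular] {K : Set Y}
    (hK : IsCompact K) (hνK : ∀ᵐ y ∂ν, y ∈ K) (v : C(Y, ℝ)) (hv : Set.InjOn v K)
    (M : Submodule ℂ (Lp ℂ 2 ν)) (hMc : IsClosed (M : Set (Lp ℂ 2 ν)))
    (hM : ∀ n : ℕ, ∃ f ∈ M, f =ᵐ[ν] fun y => (v y : ℂ) ^ n) : M = ⊤ := by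
  have hp : ∀ p : ℂ[X], ∃ f ∈ M, f =ᵐ[ν] fun y => p.eval (v y : ℂ) := by
    intro p
    induction p using Polynomial.induction_on' with
    | add p q hp hq =>
      obtain ⟨f, hf, hf'⟩ := hp
      obtain ⟨g, hg, hg'⟩ := hq
      refine ⟨f + g, M.add_mem hf hg, ?_⟩
      filter_upwards [Lp.coeFn_add f g, hf', hg'] with y h1 h2 h3
      rw [h1, Pi.add_apply, h2, h3, Polynomial.eval_add]
    | monomial n a =>
      obtain ⟨f, hf, hf'⟩ := hM n
      refine ⟨a • f, M.smul_mem a hf, ?_⟩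
      filter_upwards [Lp.coeFn_smul a f, hf'] with y h1 h2
      simp [h1, h2]
  have : CompactSpace K := isCompact_iff_compactSpace.1 hK
  let vK : C(K, ℂ) := ⟨fun y => (v y : ℂ), by fun_prop⟩
  have hdense := ContinuousMap.starSubalgebra_topologicalClosure_eq_top_of_separatesPoints
    (StarAlgebra.adjoin ℂ {vK}) (by
      intro a b hab
      refine ⟨vK, ⟨vK, StarAlgebra.subset_adjoin ℂ _ rfl, rfl⟩, ?_⟩
      intro h
      exact hab (Subtype.ext (hv a.2 b.2 (Complex.ofReal_injective h))))
  have hstar : star vK = vK := by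
    ext y
    simp [vK]
  have happrox : ∀ (b : C(K, ℂ)) (δ : ℝ), 0 < δ →
      ∃ p : ℂ[X], ∀ y : K, ‖b y - p.eval (v y : ℂ)‖ ≤ δ := by
    intro b δ hδ
    have hb : b ∈ (StarAlgebra.adjoin ℂ {vK}).topologicalClosure := hdense ▸ trivial
    rw [← SetLike.mem_coe, StarSubalgebra.topologicalClosure_coe, Metric.mem_closure_iff] at hb
    obtain ⟨a, ha, hab⟩ := hb δ hδ
    have ha' : a ∈ (StarAlgebra.adjoin ℂ {vK}).toSubalgebra := ha
    rw [StarAlgebra.adjoin_toSubalgebra, Set.star_singleton, hstar, Set.union_self,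
      Algebra.adjoin_singleton_eq_range_aeval] at ha'
    obtain ⟨p, rfl⟩ := ha'
    refine ⟨p, fun y => ?_⟩
    have h1 : (Polynomial.aeval vK p) y = p.eval (v y : ℂ) := by
      have := Polynomial.aeval_algHom_apply (ContinuousMap.evalAlgHom ℂ ℂ y) vK p
      rw [ContinuousMap.evalAlgHom_apply, Polynomial.coe_aeval_eq_eval] at this
      exact this.symm
    rw [← h1, ← dist_eq_norm]
    exact (ContinuousMap.dist_apply_le_dist y).trans hab.le
  have hb : ∀ b : BoundedContinuousFunction Y ℂ,
      BoundedContinuousFunction.toLp 2 ν ℂ b ∈ closure (M : Set (Lp ℂ 2 ν)) := by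
    intro b
    rw [Metric.mem_closure_iff]
    intro ε hε
    set C : ℝ := measureUnivNNReal ν ^ ((2 : ENNReal).toReal⁻¹) with hC
    have hC0 : 0 ≤ C := by positivity
    obtain ⟨p, hpb⟩ := happrox (b.toContinuousMap.restrict K) (ε / (C + 1)) (by positivity)
    obtain ⟨f, hf, hf'⟩ := hp p
    refine ⟨f, hf, ?_⟩
    rw [dist_eq_norm]
    have h1 : ‖BoundedContinuousFunction.toLp 2 ν ℂ b - f‖ ≤ C * (ε / (C + 1)) := by
      refine Lp.norm_le_of_ae_bound (by positivity) ?_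
      filter_upwards [Lp.coeFn_sub (BoundedContinuousFunction.toLp 2 ν ℂ b) f, hf', hνK,
        BoundedContinuousFunction.coeFn_toLp (p := 2) ν ℂ b] with y h1 h2 h3 h4
      rw [h1, Pi.sub_apply, h2, h4]
      exact hpb ⟨y, h3⟩
    refine h1.trans_lt ?_
    rw [← mul_div_assoc, div_lt_iff₀ (by positivity)]
    nlinarith
  have hd : DenseRange (BoundedContinuousFunction.toLp (E := ℂ) 2 ν ℂ) :=
    BoundedContinuousFunction.toLp_denseRange (p := 2) ℂ ν ℂ (by simp)
  rw [hMc.closure_eq] at hb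
  rw [eq_top_iff]
  intro g _
  exact hd.induction_on (p := fun g => g ∈ M) g hMc hb

/-! ### The square of a self-adjoint antilinear operator -/

section Square

variable {H : Type*} [NormedAddCommGroup H] [InnerProductSpace ℂ H]

/-- The square of a bounded antilinear operator, as a `ℂ`-linear operator. -/
def square (A : H →L⋆[ℂ] H) : H →L[ℂ] H := A.comp A

theorem square_apply (A : H →L⋆[ℂ] H) (v : H) : square A v = A (A v) := rfl

/-- The polynomial with the conjugate coefficients. -/
def conjPoly (p : ℂ[X]) : ℂ[X] := p.map (starRingEnd ℂ)

@[simp] theorem conjPoly_conjPoly (p : ℂ[X]) : conjPoly (conjPoly p) = p := by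
  simp [conjPoly, Polynomial.map_map]

theorem eval_conjPoly_ofReal (p : ℂ[X]) (t : ℝ) :
    (conjPoly p).eval (t : ℂ) = conj (p.eval (t : ℂ)) := by
  have := Polynomial.eval_map_apply (starRingEnd ℂ) (t : ℂ) (p := p)
  rwa [Complex.conj_ofReal] at this

theorem apply_aeval_square (A : H →L⋆[ℂ] H) (p : ℂ[X]) (v : H) :
    A (Polynomial.aeval (square A) p v) = Polynomial.aeval (square A) (conjPoly p) (A v) := by
  induction p using Polynomial.induction_on' with
  | add p q hp hq => simp [conjPoly, hp, hq] at *
  | monomial n a =>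
    have hn : ∀ n : ℕ, A ((square A ^ n) v) = (square A ^ n) (A v) := by
      intro n
      induction n with
      | zero => simp
      | succ n ih => simp only [pow_succ', mul_apply_eq_comp, square_apply, ih]
    simp only [conjPoly, Polynomial.map_monomial, Polynomial.aeval_monomial,
      Algebra.algebraMap_eq_smul_one, smul_mul_assoc, one_mul, smul_apply, map_smulₛₗ, hn]

variable {A : H →L⋆[ℂ] H}

/-- The complex form of self-adjointness: antilinearity upgrades the identity of real parts. -/
theorem IsSelfAdjointOp.inner_apply_comm (hA : IsSelfAdjointOp A) (a b : H) :
    inner ℂ (A a) b = inner ℂ (A b) a := by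
  have h1 := hA a b
  have h2 := hA a (Complex.I • b)
  rw [← inner_conj_symm (A b) a]
  apply Complex.ext
  · rw [Complex.conj_re, h1]
  · simp only [map_smulₛₗ, inner_smul_right, Complex.conj_I, Complex.mul_re, Complex.I_re,
      Complex.I_im, Complex.neg_re, Complex.neg_im] at h2
    rw [Complex.conj_im]
    linarith

theorem IsSelfAdjointOp.inner_square (hA : IsSelfAdjointOp A) (a b : H) :
    inner ℂ (square A a) b = inner ℂ a (square A b) := by
  rw [square_apply, hA.inner_apply_comm, ← inner_conj_symm, hA.inner_apply_comm, inner_conj_symm,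
    square_apply]

theorem IsSelfAdjointOp.isPositive_square (hA : IsSelfAdjointOp A) : (square A).IsPositive := by
  refine ⟨fun a b => hA.inner_square a b, fun a => ?_⟩
  rw [ContinuousLinearMap.reApplyInnerSelf_apply, square_apply, hA.inner_apply_comm]
  exact inner_self_nonneg

variable [CompleteSpace H]

theorem IsSelfAdjointOp.inner_aeval_square (hA : IsSelfAdjointOp A) (p : ℂ[X]) (a b : H) :
    inner ℂ (Polynomial.aeval (square A) p a) b =
      inner ℂ a (Polynomial.aeval (square A) (conjPoly p) b) := by
  induction p using Polynomial.induction_on' with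
  | add p q hp hq =>
    simp only [conjPoly, Polynomial.map_add, map_add, add_apply, inner_add_left,
      inner_add_right] at *
    rw [hp, hq]
  | monomial n c =>
    have hn : inner ℂ ((square A ^ n) a) b = inner ℂ a ((square A ^ n) b) := by
      exact (hA.isPositive_square.isSelfAdjoint.pow n).isSymmetric a b
    simp only [conjPoly, Polynomial.map_monomial, Polynomial.aeval_monomial,
      Algebra.algebraMap_eq_smul_one, smul_mul_assoc, one_mul, smul_apply, inner_smul_left,
      inner_smul_right, hn]

end Square

/-! ### Polynomials in `r²` as elements of `L²(ρ)` -/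

section RadialPolynomials

theorem inner_toLp {Y : Type*} [MeasurableSpace Y] {ν : Measure Y} {f g : Y → ℂ}
    (hf : MemLp f 2 ν) (hg : MemLp g 2 ν) :
    inner ℂ (hf.toLp f) (hg.toLp g) = ∫ y, conj (f y) * g y ∂ν := by
  rw [L2.inner_def]
  refine integral_congr_ae ?_
  filter_upwards [hf.coeFn_toLp, hg.coeFn_toLp] with y h1 h2
  rw [h1, h2, RCLike.inner_apply, mul_comm]

variable {ρ : Measure ℝ≥0} {M : ℝ≥0}

/-- The function `r ↦ p(r²)` on `[0, ∞)`. -/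
def evalSq (p : ℂ[X]) (r : ℝ≥0) : ℂ := p.eval ((r : ℂ) ^ 2)

theorem continuous_evalSq (p : ℂ[X]) : Continuous (evalSq p) := by
  unfold evalSq
  exact p.continuous.comp (by fun_prop)

theorem evalSq_conjPoly (p : ℂ[X]) (r : ℝ≥0) : evalSq (conjPoly p) r = conj (evalSq p r) := by
  have := eval_conjPoly_ofReal p ((r : ℝ) ^ 2)
  push_cast at this
  exact this

theorem evalSq_mul (p q : ℂ[X]) (r : ℝ≥0) : evalSq (p * q) r = evalSq p r * evalSq q r := by
  simp [evalSq]

theorem evalSq_X (r : ℝ≥0) : evalSq Polynomial.X r = (r : ℂ) ^ 2 := by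
  simp [evalSq]

theorem exists_bound_of_continuous {f : ℝ≥0 → ℂ} (hf : Continuous f) (hM : ∀ᵐ r ∂ρ, r ≤ M) :
    ∃ C : ℝ, ∀ᵐ r ∂ρ, ‖f r‖ ≤ C := by
  obtain ⟨C, hC⟩ := (isCompact_Icc (a := (0 : ℝ≥0)) (b := M)).exists_bound_of_continuousOn
    hf.continuousOn
  exact ⟨C, hM.mono fun r hr => hC r ⟨zero_le, hr⟩⟩

variable [IsFiniteMeasure ρ]

theorem memLp_of_continuous {f : ℝ≥0 → ℂ} (hf : Continuous f) (hM : ∀ᵐ r ∂ρ, r ≤ M) :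
    MemLp f 2 ρ := by
  obtain ⟨C, hC⟩ := exists_bound_of_continuous hf hM
  exact MemLp.of_bound hf.aestronglyMeasurable C hC

theorem memLp_evalSq (hM : ∀ᵐ r ∂ρ, r ≤ M) (p : ℂ[X]) : MemLp (evalSq p) 2 ρ :=
  memLp_of_continuous (continuous_evalSq p) hM

/-- The class of `r ↦ p(r²)` in `L²(ρ)`, for `ρ` with bounded support. -/
def polyLp (hM : ∀ᵐ r ∂ρ, r ≤ M) : ℂ[X] →ₗ[ℂ] Lp ℂ 2 ρ where
  toFun p := (memLp_evalSq hM p).toLp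
  map_add' p q := by
    rw [← MemLp.toLp_add]
    congr 1
    ext r
    simp [evalSq]
  map_smul' c p := by
    rw [RingHom.id_apply, ← MemLp.toLp_const_smul]
    congr 1
    ext r
    simp [evalSq]

theorem polyLp_apply (hM : ∀ᵐ r ∂ρ, r ≤ M) (p : ℂ[X]) :
    polyLp hM p = (memLp_evalSq hM p).toLp := rfl

theorem denseRange_polyLp (hM : ∀ᵐ r ∂ρ, r ≤ M) : DenseRange (polyLp hM) := by
  have h := eq_top_of_pow_mem ρ (isCompact_Icc (a := (0 : ℝ≥0)) (b := M))
    (hM.mono fun r hr => ⟨zero_le, hr⟩) ⟨fun r : ℝ≥0 => (r : ℝ) ^ 2, by fun_prop⟩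
    (fun a _ b _ hab => by
      have : (a : ℝ) = b := (pow_left_inj₀ a.2 b.2 two_ne_zero).1 hab
      exact_mod_cast this)
    (LinearMap.range (polyLp hM)).topologicalClosure (Submodule.isClosed_topologicalClosure _)
    (fun n => ⟨polyLp hM (Polynomial.X ^ n),
      Submodule.le_topologicalClosure _ ⟨_, rfl⟩, by
        refine (memLp_evalSq hM _).coeFn_toLp.trans (.of_forall fun r => ?_)
        simp [evalSq]⟩)
  rw [DenseRange, ← LinearMap.coe_range]
  exact Submodule.dense_iff_topologicalClosure_eq_top.2 h

theorem ext_inner_polyLp (hM : ∀ᵐ r ∂ρ, r ≤ M) {f g : Lp ℂ 2 ρ}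
    (h : ∀ q, inner ℂ f (polyLp hM q) = inner ℂ g (polyLp hM q)) : f = g := by
  refine ext_inner_right ℂ fun v => ?_
  exact (denseRange_polyLp hM).induction_on v (isClosed_eq (by fun_prop) (by fun_prop)) h

end RadialPolynomials

/-! ### The Gram matrix of the vectors `p(T) x` and `q(T) A x` -/

section CrossDensity

variable {H : Type*} [NormedAddCommGroup H] [InnerProductSpace ℂ H] [CompleteSpace H]
  {A : H →L⋆[ℂ] H} {ρ : Measure ℝ≥0} [IsFiniteMeasure ρ] {M : ℝ≥0} {x : H}

omit [CompleteSpace H] in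
theorem inner_aeval_self (hM : ∀ᵐ r ∂ρ, r ≤ M)
    (hmom : ∀ n : ℕ, inner ℂ x ((square A ^ n) x) = ((∫ r : ℝ≥0, (r : ℝ) ^ (2 * n) ∂ρ : ℝ) : ℂ))
    (p : ℂ[X]) : inner ℂ x (Polynomial.aeval (square A) p x) = ∫ r, evalSq p r ∂ρ := by
  induction p using Polynomial.induction_on' with
  | add p q hp hq =>
    have h : evalSq (p + q) = fun r => evalSq p r + evalSq q r := by ext; simp [evalSq]
    rw [h, integral_add ((memLp_evalSq hM p).integrable one_le_two)
      ((memLp_evalSq hM q).integrable one_le_two), ← hp, ← hq]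
    simp
  | monomial n c =>
    have h : evalSq (Polynomial.monomial n c) =
        fun r : ℝ≥0 => c * (((r : ℝ) ^ (2 * n) : ℝ) : ℂ) := by
      ext r
      simp [evalSq, pow_mul]
    rw [h, integral_const_mul, integral_complex_ofReal, ← hmom]
    simp [Polynomial.aeval_monomial, Algebra.algebraMap_eq_smul_one]

theorem inner_aeval_aeval (hA : IsSelfAdjointOp A) (hM : ∀ᵐ r ∂ρ, r ≤ M)
    (hmom : ∀ n : ℕ, inner ℂ x ((square A ^ n) x) = ((∫ r : ℝ≥0, (r : ℝ) ^ (2 * n) ∂ρ : ℝ) : ℂ))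
    (p q : ℂ[X]) : inner ℂ (Polynomial.aeval (square A) p x) (Polynomial.aeval (square A) q x) =
      ∫ r, conj (evalSq p r) * evalSq q r ∂ρ := by
  rw [hA.inner_aeval_square, ← mul_apply_eq_comp, ← map_mul,
    inner_aeval_self hM hmom]
  simp_rw [evalSq_mul, evalSq_conjPoly]

/-- The functional `f ↦ ⟪A x, f(T) x⟫` has a density `s` with respect to `ρ`, and `|s| ≤ r`. With the
isometry `W : L²(ρ) → H`, `p(r²) ↦ p(T) x`, one has `s = W† A x`. For a Borel set `E`, density of the
polynomials gives `W† A W 1_E = s 1_E` and `W† A² W 1_E = r² 1_E`, so that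
`∫_E |s|² ≤ ‖A W 1_E‖² = ∫_E r²`. -/
theorem exists_cross_density (hA : IsSelfAdjointOp A) (hM : ∀ᵐ r ∂ρ, r ≤ M)
    (hmom : ∀ n : ℕ, inner ℂ x ((square A ^ n) x) = ((∫ r : ℝ≥0, (r : ℝ) ^ (2 * n) ∂ρ : ℝ) : ℂ)) :
    ∃ s : ℝ≥0 → ℂ, Measurable s ∧ (∀ᵐ r ∂ρ, ‖s r‖ ≤ r) ∧ ∀ p : ℂ[X],
      inner ℂ (A x) (Polynomial.aeval (square A) p x) = ∫ r, conj (s r) * evalSq p r ∂ρ := by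
  let P : ℂ[X] →ₗ[ℂ] H :=
    { toFun := fun p => Polynomial.aeval (square A) p x
      map_add' := fun p q => by simp
      map_smul' := fun c p => by simp }
  have hinner : ∀ p q, inner ℂ (P p) (P q) = inner ℂ (polyLp hM p) (polyLp hM q) := fun p q => by
    rw [polyLp_apply, polyLp_apply, inner_toLp]
    exact inner_aeval_aeval hA hM hmom p q
  have hnorm : ∀ p, ‖P p‖ = ‖polyLp hM p‖ := fun p => by
    rw [@norm_eq_sqrt_re_inner ℂ, @norm_eq_sqrt_re_inner ℂ, hinner]
  have hdense := denseRange_polyLp hM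
  let W : Lp ℂ 2 ρ →L[ℂ] H := P.extendOfNorm (polyLp hM)
  have hW : ∀ p, W (polyLp hM p) = P p := fun p =>
    LinearMap.extendOfNorm_eq hdense ⟨1, fun p => by rw [hnorm, one_mul]⟩ p
  have hWn : ∀ f, ‖W f‖ = ‖f‖ := fun f =>
    hdense.induction_on f (isClosed_eq (by fun_prop) (by fun_prop)) fun p => by rw [hW, hnorm]
  have hWi : ∀ f g, inner ℂ (W f) (W g) = inner ℂ f g :=
    LinearMap.norm_map_iff_inner_map_map W |>.1 hWn
  let V := ContinuousLinearMap.adjoint W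
  have hVn : ∀ v, ‖V v‖ ≤ ‖v‖ := by
    intro v
    have h1 : ‖V‖ ≤ 1 := by
      rw [LinearIsometryEquiv.norm_map]
      exact W.opNorm_le_bound zero_le_one fun f => by rw [hWn, one_mul]
    exact (V.le_of_opNorm_le h1 v).trans_eq (one_mul _)
  have hV : ∀ v f, inner ℂ (V v) f = inner ℂ v (W f) := fun v f =>
    ContinuousLinearMap.adjoint_inner_left W f v
  set s : Lp ℂ 2 ρ := V (A x) with hs
  have hsm : Measurable s := (Lp.stronglyMeasurable s).measurable
  have hsL : MemLp s 2 ρ := Lp.memLp s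
  have hsP : ∀ p, inner ℂ (A x) (P p) = ∫ r, conj (s r) * evalSq p r ∂ρ := by
    intro p
    rw [← hW, ← hV, ← hs]
    conv_lhs => rw [← Lp.toLp_coeFn s hsL]
    rw [polyLp_apply, inner_toLp]
  refine ⟨s, hsm, ?_, hsP⟩
  have hse : ∀ p, MemLp (fun r => s r * evalSq p r) 2 ρ := by
    intro p
    obtain ⟨C, hC⟩ := exists_bound_of_continuous (continuous_evalSq p) hM
    refine hsL.of_le_mul (c := C)
      (hsm.mul (continuous_evalSq p).measurable).aestronglyMeasurable ?_
    filter_upwards [hC] with r hr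
    rw [norm_mul, mul_comm]
    gcongr
  -- `W† A q(T) x = s q̄(r²)`: the compression of `A` to `L²(ρ)` acts on polynomials as `q ↦ s q̄`.
  have hVA : ∀ q, V (A (P q)) = (hse (conjPoly q)).toLp := by
    intro q
    refine ext_inner_polyLp hM fun p => ?_
    rw [hV, hW, polyLp_apply, inner_toLp]
    have h1 : A (P q) = Polynomial.aeval (square A) (conjPoly q) (A x) := apply_aeval_square A q x
    rw [h1, hA.inner_aeval_square, conjPoly_conjPoly]
    have h2 : Polynomial.aeval (square A) q (P p) = P (q * p) := by
      simp [P]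
    rw [h2, hsP]
    simp_rw [evalSq_mul, evalSq_conjPoly, map_mul, Complex.conj_conj, mul_assoc]
  -- Indicators are handled by duality, using the formula for `W† A W` on polynomials only.
  have hset : ∀ E : Set ℝ≥0, MeasurableSet E →
      ∫ r in E, ‖s r‖ ^ 2 ∂ρ ≤ ∫ r in E, (r : ℝ) ^ 2 ∂ρ := by
    intro E hE
    have hf : MemLp (E.indicator fun _ => (1 : ℂ)) 2 ρ := memLp_indicator_const 2 hE 1 (by simp)
    have hsf : MemLp (E.indicator s) 2 ρ := hsL.indicator hE
    have hrL : MemLp (fun r : ℝ≥0 => (r : ℂ) ^ 2) 2 ρ := memLp_of_continuous (by fun_prop) hM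
    have hrf : MemLp (E.indicator fun r : ℝ≥0 => (r : ℂ) ^ 2) 2 ρ := hrL.indicator hE
    have h1 : V (A (W hf.toLp)) = hsf.toLp := by
      refine ext_inner_polyLp hM fun q => ?_
      rw [hV, hA.inner_apply_comm, hW, ← hV, hVA, inner_toLp, polyLp_apply, inner_toLp]
      refine integral_congr_ae (.of_forall fun r => ?_)
      by_cases hr : r ∈ E <;> simp [hr, evalSq_conjPoly]
    have h2 : V (square A (W hf.toLp)) = hrf.toLp := by
      refine ext_inner_polyLp hM fun q => ?_
      have h3 : square A (P q) = P (Polynomial.X * q) := by simp [P]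
      rw [hV, hA.inner_square, hW, h3, ← hW, hWi, polyLp_apply, inner_toLp, polyLp_apply,
        inner_toLp]
      refine integral_congr_ae (.of_forall fun r => ?_)
      by_cases hr : r ∈ E <;> simp [hr, evalSq_mul, evalSq_X]
    have h3 : ((‖hsf.toLp‖ ^ 2 : ℝ) : ℂ) = ((∫ r in E, ‖s r‖ ^ 2 ∂ρ : ℝ) : ℂ) := by
      have := inner_self_eq_norm_sq_to_K (𝕜 := ℂ) hsf.toLp
      rw [inner_toLp] at this
      rw [Complex.ofReal_pow]
      refine this.symm.trans ?_
      rw [← integral_indicator hE, ← integral_complex_ofReal]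
      refine integral_congr_ae (.of_forall fun r => ?_)
      by_cases hr : r ∈ E <;> simp [hr, Complex.conj_mul']
    have h4 : ((‖A (W hf.toLp)‖ ^ 2 : ℝ) : ℂ) = ((∫ r in E, (r : ℝ) ^ 2 ∂ρ : ℝ) : ℂ) := by
      have := inner_self_eq_norm_sq_to_K (𝕜 := ℂ) (A (W hf.toLp))
      rw [hA.inner_apply_comm, ← square_apply, ← hV, h2, inner_toLp] at this
      rw [Complex.ofReal_pow]
      refine this.symm.trans ?_
      rw [← integral_indicator hE, ← integral_complex_ofReal]
      refine integral_congr_ae (.of_forall fun r => ?_)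
      by_cases hr : r ∈ E <;> simp [hr]
    rw [← Complex.ofReal_inj.1 h3, ← Complex.ofReal_inj.1 h4, ← h1]
    have := hVn (A (W hf.toLp))
    gcongr
  have hle : (fun r => ‖s r‖ ^ 2) ≤ᵐ[ρ] fun r : ℝ≥0 => (r : ℝ) ^ 2 := by
    refine ae_le_of_forall_setIntegral_le hsL.integrable_norm_pow' ?_ fun E hE _ => hset E hE
    have : MemLp (fun r : ℝ≥0 => (r : ℂ)) 2 ρ := memLp_of_continuous (by fun_prop) hM
    simpa using this.integrable_norm_pow'
  filter_upwards [hle] with r hr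
  exact (pow_le_pow_iff_left₀ (norm_nonneg _) r.2 two_ne_zero).1 hr

end CrossDensity

/-! ### Spreading a measure on the half-line over the real line -/

section SymmetricExtension

/-- The measure on `ℂ`, carried by the real line, that distributes `ρ` over the points `r` and `-r`
in the proportion `(1 + w(r)) / 2` to `(1 - w(r)) / 2`. -/
def symmetricExtension (ρ : Measure ℝ≥0) (w : ℝ≥0 → ℝ) : Measure ℂ :=
  planeMeasure (ρ.withDensity fun r => (Real.toNNReal ((1 - w r) / 2) : ℝ≥0)) (fun _ => Real.pi) +
    planeMeasure (ρ.withDensity fun r => (Real.toNNReal ((1 + w r) / 2) : ℝ≥0)) (fun _ => 0)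

variable {ρ : Measure ℝ≥0} {w : ℝ≥0 → ℝ}

theorem symmetricExtension_eq : symmetricExtension ρ w =
    (ρ.withDensity fun r => (Real.toNNReal ((1 - w r) / 2) : ℝ≥0)).map (fun r : ℝ≥0 => -(r : ℂ)) +
    (ρ.withDensity fun r => (Real.toNNReal ((1 + w r) / 2) : ℝ≥0)).map (fun r : ℝ≥0 => (r : ℂ)) := by
  unfold symmetricExtension planeMeasure
  congr 2
  · ext r
    rw [mul_comm Complex.I, Complex.exp_pi_mul_I, mul_neg_one]
  · ext r
    simp

theorem withDensity_add_withDensity (hw : Measurable w) (h0 : ∀ r, 0 ≤ w r) (h1 : ∀ r, w r ≤ 1) :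
    (ρ.withDensity fun r => (Real.toNNReal ((1 - w r) / 2) : ℝ≥0)) +
      (ρ.withDensity fun r => (Real.toNNReal ((1 + w r) / 2) : ℝ≥0)) = ρ := by
  rw [← withDensity_add_left (by fun_prop)]
  conv_rhs => rw [← withDensity_one (μ := ρ)]
  congr 1
  ext r
  have := h0 r
  have := h1 r
  rw [Pi.add_apply, ← ENNReal.coe_add, ← Real.toNNReal_add (by linarith) (by linarith)]
  have : (1 - w r) / 2 + (1 + w r) / 2 = 1 := by ring
  simp [this]

theorem isSymmetricBiradial_symmetricExtension [IsProbabilityMeasure ρ] (hw : Measurable w)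
    (h0 : ∀ r, 0 ≤ w r) (h1 : ∀ r, w r ≤ 1) : IsSymmetricBiradial (symmetricExtension ρ w) := by
  refine ⟨_, _, fun _ => Real.pi, fun _ => 0, ⟨measurable_const, measurable_const, ?_, rfl⟩,
    fun r => ⟨0, by simp⟩⟩
  rw [← Measure.add_apply, withDensity_add_withDensity hw h0 h1, measure_univ]

theorem measurePreserving_nnnorm_symmetricExtension (hw : Measurable w)
    (h0 : ∀ r, 0 ≤ w r) (h1 : ∀ r, w r ≤ 1) :
    MeasurePreserving (fun z : ℂ => ‖z‖₊) (symmetricExtension ρ w) ρ := by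
  refine ⟨by fun_prop, ?_⟩
  rw [symmetricExtension_eq, Measure.map_add _ _ (by fun_prop),
    Measure.map_map (by fun_prop) (by fun_prop), Measure.map_map (by fun_prop) (by fun_prop)]
  have h2 : (fun z : ℂ => ‖z‖₊) ∘ (fun r : ℝ≥0 => -(r : ℂ)) = id := by
    ext r
    simp
  have h3 : (fun z : ℂ => ‖z‖₊) ∘ (fun r : ℝ≥0 => (r : ℂ)) = id := by
    ext r
    simp
  rw [h2, h3, Measure.map_id, Measure.map_id, withDensity_add_withDensity hw h0 h1]

theorem ae_im_eq_zero_symmetricExtension : ∀ᵐ z ∂(symmetricExtension ρ w), z.im = 0 := by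
  have hm : MeasurableSet {z : ℂ | z.im = 0} :=
    measurableSet_eq_fun Complex.measurable_im measurable_const
  rw [symmetricExtension_eq, ae_add_measure_iff, ae_map_iff (by fun_prop) hm,
    ae_map_iff (by fun_prop) hm]
  constructor <;> exact .of_forall fun r => by simp

theorem integral_symmetricExtension (hw : Measurable w) (h0 : ∀ r, 0 ≤ w r) (h1 : ∀ r, w r ≤ 1)
    {G : ℂ → ℂ} (hG : Integrable G (symmetricExtension ρ w)) :
    ∫ z, G z ∂(symmetricExtension ρ w) =
      ∫ r : ℝ≥0, ((1 - w r) / 2 * G (-(r : ℂ)) + (1 + w r) / 2 * G (r : ℂ) : ℂ) ∂ρ := by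
  have hd1 : Measurable fun r => Real.toNNReal ((1 - w r) / 2) := by fun_prop
  have hd2 : Measurable fun r => Real.toNNReal ((1 + w r) / 2) := by fun_prop
  rw [symmetricExtension_eq] at hG ⊢
  obtain ⟨hG1, hG2⟩ := integrable_add_measure.1 hG
  rw [integral_add_measure hG1 hG2, integral_map (by fun_prop) hG1.aestronglyMeasurable,
    integral_map (by fun_prop) hG2.aestronglyMeasurable,
    integral_withDensity_eq_integral_smul hd1, integral_withDensity_eq_integral_smul hd2,
    ← integral_add]
  · refine integral_congr_ae (.of_forall fun r => ?_)
    have := h0 r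
    have := h1 r
    simp only [NNReal.smul_def, Complex.real_smul]
    rw [Real.coe_toNNReal _ (by linarith), Real.coe_toNNReal _ (by linarith)]
    push_cast
    rfl
  · exact (integrable_withDensity_iff_integrable_smul hd1).1
      ((integrable_map_measure hG1.aestronglyMeasurable (by fun_prop)).1 hG1)
  · exact (integrable_withDensity_iff_integrable_smul hd2).1
      ((integrable_map_measure hG2.aestronglyMeasurable (by fun_prop)).1 hG2)

end SymmetricExtension

/-! ### A dense family in `L²(μ)` -/

section PhasedPolynomials

/-- A closed subspace of `L²(μ)` containing `c(z) p(|z|²)` for all polynomials `p` contains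
`c(z) k(|z|)` for all `k ∈ L²(ρ)`, when `ρ` is the image of `μ` under `z ↦ |z|` and `c` is bounded. -/
theorem exists_mem_ae_eq_mul_comp_nnnorm {ρ : Measure ℝ≥0} [IsFiniteMeasure ρ] {M : ℝ≥0}
    (hM : ∀ᵐ r ∂ρ, r ≤ M) {μ : Measure ℂ} (hμ : MeasurePreserving (fun z : ℂ => ‖z‖₊) μ ρ)
    {c : ℂ → ℂ} (hc : Measurable c) {C : ℝ} (hC : ∀ᵐ z ∂μ, ‖c z‖ ≤ C)
    {S : Submodule ℂ (Lp ℂ 2 μ)} (hS : IsClosed (S : Set (Lp ℂ 2 μ)))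
    (hp : ∀ p : ℂ[X], ∃ f ∈ S, f =ᵐ[μ] fun z => c z * evalSq p ‖z‖₊)
    {k : ℝ≥0 → ℂ} (hk : MemLp k 2 ρ) : ∃ f ∈ S, f =ᵐ[μ] fun z => c z * k ‖z‖₊ := by
  have hkμ : MemLp (fun z : ℂ => k ‖z‖₊) 2 μ := hk.comp_measurePreserving hμ
  have hF : MemLp (fun z => c z * k ‖z‖₊) 2 μ := by
    refine hkμ.of_le_mul (c := C) (hc.aestronglyMeasurable.mul hkμ.aestronglyMeasurable) ?_
    filter_upwards [hC] with z hz
    rw [norm_mul]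
    gcongr
  refine ⟨hF.toLp, ?_, hF.coeFn_toLp⟩
  rw [← SetLike.mem_coe, ← hS.closure_eq, Metric.mem_closure_iff]
  intro ε hε
  obtain ⟨p, hpε⟩ := (denseRange_polyLp hM).exists_dist_lt hk.toLp
    (show 0 < ε / (|C| + 1) by positivity)
  obtain ⟨f, hfS, hf⟩ := hp p
  refine ⟨f, hfS, ?_⟩
  set d := hk.toLp - polyLp hM p with hd
  have hdc : d =ᵐ[ρ] fun r => k r - evalSq p r := by
    filter_upwards [Lp.coeFn_sub hk.toLp (polyLp hM p), hk.coeFn_toLp,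
      (memLp_evalSq hM p).coeFn_toLp] with r h1 h2 h3
    rw [hd, h1, Pi.sub_apply, h2, polyLp_apply, h3]
  have h1 : ‖hF.toLp - f‖ ≤ C * ‖Lp.compMeasurePreserving (fun z : ℂ => ‖z‖₊) hμ d‖ := by
    refine Lp.norm_le_mul_norm_of_ae_le_mul ?_
    filter_upwards [Lp.coeFn_sub hF.toLp f, hF.coeFn_toLp, hf, hC,
      Lp.coeFn_compMeasurePreserving d hμ, hμ.quasiMeasurePreserving.ae_eq_comp hdc]
      with z h1 h2 h3 h4 h5 h6
    rw [h1, Pi.sub_apply, h2, h3, h5, h6, ← mul_sub, norm_mul]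
    exact mul_le_mul_of_nonneg_right h4 (norm_nonneg _)
  rw [Lp.norm_compMeasurePreserving] at h1
  rw [dist_eq_norm] at hpε ⊢
  rw [lt_div_iff₀ (by positivity)] at hpε
  have := mul_le_mul_of_nonneg_right (le_abs_self C) (norm_nonneg d)
  have := norm_nonneg d
  nlinarith

/-- The function representing `p(T) x + q(T) A x` in the model. -/
def phasedPoly (u : ℝ≥0 → ℂ) (p q : ℂ[X]) (z : ℂ) : ℂ :=
  conj (u ‖z‖₊) * evalSq p ‖z‖₊ + z * u ‖z‖₊ * evalSq q ‖z‖₊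

/-- In the model, `(p, q) ↦ (X q̄, p̄)` is the operator `f ↦ z f̄`; compare `apply_orbitMap`. -/
theorem phasedPoly_conj (u : ℝ≥0 → ℂ) (p q : ℂ[X]) (z : ℂ) :
    phasedPoly u (Polynomial.X * conjPoly q) (conjPoly p) z = z * conj (phasedPoly u p q z) := by
  have h : ((‖z‖₊ : ℝ) : ℂ) ^ 2 = z * conj z := by
    rw [Complex.mul_conj']
    simp
  simp only [phasedPoly, evalSq_mul, evalSq_X, evalSq_conjPoly, map_add, map_mul,
    Complex.conj_conj, h]
  ring

variable {ρ : Measure ℝ≥0} [IsFiniteMeasure ρ] {M : ℝ≥0} {μ : Measure ℂ} {u : ℝ≥0 → ℂ}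

omit [IsFiniteMeasure ρ] in
theorem ae_norm_le (hM : ∀ᵐ r ∂ρ, r ≤ M) (hμ : MeasurePreserving (fun z : ℂ => ‖z‖₊) μ ρ) :
    ∀ᵐ z ∂μ, ‖z‖ ≤ M :=
  (hμ.quasiMeasurePreserving.ae hM).mono fun _ hz => hz

theorem memLp_phasedPoly (hM : ∀ᵐ r ∂ρ, r ≤ M)
    (hμ : MeasurePreserving (fun z : ℂ => ‖z‖₊) μ ρ) (hu : Measurable u) (hu1 : ∀ r, ‖u r‖ = 1)
    (p q : ℂ[X]) : MemLp (phasedPoly u p q) 2 μ := by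
  have hp : ∀ p, MemLp (fun z : ℂ => evalSq p ‖z‖₊) 2 μ := fun p =>
    (memLp_evalSq hM p).comp_measurePreserving hμ
  have hum : Measurable fun z : ℂ => u ‖z‖₊ := hu.comp measurable_nnnorm
  refine MemLp.add ((hp p).of_le_mul (c := 1) ?_ ?_) ((hp q).of_le_mul (c := M) ?_ ?_)
  · exact ((RCLike.continuous_conj.measurable.comp hum)).aestronglyMeasurable.mul
      (hp p).aestronglyMeasurable
  · exact .of_forall fun z => by simp [hu1]
  · exact (measurable_id.mul hum).aestronglyMeasurable.mul (hp q).aestronglyMeasurable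
  · filter_upwards [ae_norm_le hM hμ] with z hz
    rw [norm_mul, norm_mul, hu1, mul_one]
    gcongr

/-- The class of `phasedPoly u p q` in `L²(μ)`, as a linear map of the pair `(p, q)`. -/
def phasedPolyLp (hM : ∀ᵐ r ∂ρ, r ≤ M)
    (hμ : MeasurePreserving (fun z : ℂ => ‖z‖₊) μ ρ) (hu : Measurable u) (hu1 : ∀ r, ‖u r‖ = 1) :
    ℂ[X] × ℂ[X] →ₗ[ℂ] Lp ℂ 2 μ where
  toFun e := (memLp_phasedPoly hM hμ hu hu1 e.1 e.2).toLp
  map_add' e e' := by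
    rw [← MemLp.toLp_add]
    congr 1
    ext z
    simp [phasedPoly, evalSq]
    ring
  map_smul' c e := by
    rw [RingHom.id_apply, ← MemLp.toLp_const_smul]
    congr 1
    ext z
    simp [phasedPoly, evalSq]
    ring

/-- Every power of `z` is in the closed range: replacing `p` by an `L²(ρ)` function absorbs the phase,
`z²ᵐ = ū(|z|) · u(|z|) |z|²ᵐ` and `z²ᵐ⁺¹ = z u(|z|) · ū(|z|) |z|²ᵐ` for real `z`. -/
theorem denseRange_phasedPolyLp (hM : ∀ᵐ r ∂ρ, r ≤ M)
    (hμ : MeasurePreserving (fun z : ℂ => ‖z‖₊) μ ρ) (hu : Measurable u) (hu1 : ∀ r, ‖u r‖ = 1)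
    (him : ∀ᵐ z ∂μ, z.im = 0) : DenseRange (phasedPolyLp hM hμ hu hu1) := by
  have : IsFiniteMeasure μ := ⟨by
    rw [← Set.preimage_univ (f := fun z : ℂ => ‖z‖₊),
      hμ.measure_preimage MeasurableSet.univ.nullMeasurableSet]
    exact measure_lt_top ρ _⟩
  set S := (LinearMap.range (phasedPolyLp hM hμ hu hu1)).topologicalClosure with hS
  have hSc : IsClosed (S : Set (Lp ℂ 2 μ)) := Submodule.isClosed_topologicalClosure _
  have hSm : ∀ p q, ∃ f ∈ S, f =ᵐ[μ] phasedPoly u p q := fun p q =>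
    ⟨phasedPolyLp hM hμ hu hu1 (p, q), Submodule.le_topologicalClosure _ ⟨_, rfl⟩,
      (memLp_phasedPoly hM hμ hu hu1 p q).coeFn_toLp⟩
  have hum : Measurable fun z : ℂ => u ‖z‖₊ := hu.comp measurable_nnnorm
  have huc : Measurable fun r => conj (u r) := RCLike.continuous_conj.measurable.comp hu
  have hucm : Measurable fun z : ℂ => conj (u ‖z‖₊) := huc.comp measurable_nnnorm
  have huu : ∀ r, conj (u r) * u r = 1 := fun r => by
    rw [Complex.conj_mul', hu1]
    simp
  have hpow : ∀ n : ℕ, MemLp (fun r : ℝ≥0 => (r : ℂ) ^ n) 2 ρ := fun n =>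
    memLp_of_continuous (by fun_prop) hM
  have hK : IsCompact (Metric.closedBall (0 : ℂ) M ∩ {z | z.im = 0}) :=
    (isCompact_closedBall _ _).inter_right (isClosed_eq Complex.continuous_im continuous_const)
  have hsq : ∀ z : ℂ, z.im = 0 → ((‖z‖₊ : ℝ) : ℂ) ^ 2 = (z.re : ℂ) ^ 2 := by
    intro z hz
    have h1 : z = (z.re : ℂ) := Complex.ext rfl (by simp [hz])
    rw [coe_nnnorm, h1]
    simp only [Complex.norm_real, Complex.ofReal_re, Real.norm_eq_abs]
    exact_mod_cast sq_abs z.re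
  have htop : S = ⊤ := by
    refine eq_top_of_pow_mem μ hK ?_ ⟨Complex.re, Complex.continuous_re⟩ ?_ S hSc ?_
    · filter_upwards [ae_norm_le hM hμ, him] with z h1 h2
      exact ⟨by simpa using h1, h2⟩
    · intro a ha b hb hab
      exact Complex.ext hab (ha.2.trans hb.2.symm)
    · intro n
      obtain ⟨m, rfl | rfl⟩ := n.even_or_odd'
      · obtain ⟨f, hfS, hf⟩ := exists_mem_ae_eq_mul_comp_nnnorm hM hμ hucm (C := 1)
          (.of_forall fun z => by simp [hu1]) hSc
          (fun p => by
            obtain ⟨f, hfS, hf⟩ := hSm p 0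
            exact ⟨f, hfS, hf.trans (.of_forall fun z => by simp [phasedPoly, evalSq])⟩)
          (k := fun r => u r * (r : ℂ) ^ (2 * m)) ((hpow (2 * m)).of_le_mul (c := 1)
            (hu.aestronglyMeasurable.mul (hpow _).aestronglyMeasurable)
            (.of_forall fun r => by simp [hu1]))
        refine ⟨f, hfS, ?_⟩
        filter_upwards [hf, him] with z h1 h2
        rw [h1, ← mul_assoc, huu, one_mul, pow_mul, hsq z h2, ← pow_mul]
        rfl
      · obtain ⟨f, hfS, hf⟩ := exists_mem_ae_eq_mul_comp_nnnorm hM hμ (measurable_id.mul hum)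
          (C := M)
          (by filter_upwards [ae_norm_le hM hμ] with z hz; simpa [hu1] using hz) hSc
          (fun q => by
            obtain ⟨f, hfS, hf⟩ := hSm 0 q
            exact ⟨f, hfS, hf.trans (.of_forall fun z => by simp [phasedPoly, evalSq])⟩)
          (k := fun r => conj (u r) * (r : ℂ) ^ (2 * m)) ((hpow (2 * m)).of_le_mul (c := 1)
            (huc.aestronglyMeasurable.mul (hpow _).aestronglyMeasurable)
            (.of_forall fun r => by simp [hu1]))
        refine ⟨f, hfS, ?_⟩
        filter_upwards [hf, him] with z h1 h2
        have h3 : z = (z.re : ℂ) := Complex.ext rfl (by simp [h2])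
        have h4 : ((‖z‖₊ : ℝ) : ℂ) ^ (2 * m) = (z.re : ℂ) ^ (2 * m) := by
          rw [pow_mul, hsq z h2, ← pow_mul]
        have h5 : (ContinuousMap.mk Complex.re Complex.continuous_re z : ℂ) = z := h3.symm
        rw [h1, Pi.mul_apply, id, h4, ← h3, h5]
        linear_combination z ^ (2 * m + 1) * huu ‖z‖₊
  rw [DenseRange, ← LinearMap.coe_range]
  exact Submodule.dense_iff_topologicalClosure_eq_top.2 htop

end PhasedPolynomials

/-! ### The dense family in `H` -/

section Orbit

variable {H : Type*} [NormedAddCommGroup H] [InnerProductSpace ℂ H]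

/-- The linear map `(p, q) ↦ p(T) x + q(T) A x`, where `T = A²`. -/
def orbitMap (A : H →L⋆[ℂ] H) (x : H) : ℂ[X] × ℂ[X] →ₗ[ℂ] H where
  toFun e := Polynomial.aeval (square A) e.1 x + Polynomial.aeval (square A) e.2 (A x)
  map_add' e e' := by
    simp only [Prod.fst_add, Prod.snd_add, map_add, add_apply]
    abel
  map_smul' c e := by simp

theorem orbitMap_apply (A : H →L⋆[ℂ] H) (x : H) (p q : ℂ[X]) : orbitMap A x (p, q) =
    Polynomial.aeval (square A) p x + Polynomial.aeval (square A) q (A x) := rfl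

theorem apply_orbitMap (A : H →L⋆[ℂ] H) (x : H) (p q : ℂ[X]) :
    A (orbitMap A x (p, q)) = orbitMap A x (Polynomial.X * conjPoly q, conjPoly p) := by
  rw [orbitMap_apply, orbitMap_apply, map_add, apply_aeval_square, apply_aeval_square, add_comm,
    mul_comm, map_mul, mul_apply_eq_comp, Polynomial.aeval_X, square_apply]

theorem denseRange_orbitMap {A : H →L⋆[ℂ] H} {x : H} (hx : IsCyclicVector A x) :
    DenseRange (orbitMap A x) := by
  have hit : ∀ k : ℕ, (⇑A)^[k] x ∈ LinearMap.range (orbitMap A x) := by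
    intro k
    induction k with
    | zero => exact ⟨(1, 0), by simp [orbitMap_apply]⟩
    | succ k ih =>
      obtain ⟨⟨p, q⟩, h⟩ := ih
      rw [Function.iterate_succ_apply', ← h, apply_orbitMap]
      exact ⟨_, rfl⟩
  have hsub : {y : H | ∃ p : ℂ[X], y = polyApply A p x} ⊆ Set.range (orbitMap A x) := by
    rintro y ⟨p, rfl⟩
    rw [← LinearMap.coe_range]
    exact Submodule.sum_mem _ fun k _ => Submodule.smul_mem _ _ (hit k)
  exact Dense.mono hsub (dense_iff_closure_eq.2 hx)

theorem denseRange_orbitMap_smul {A : H →L⋆[ℂ] H} {x : H} (hx : DenseRange (orbitMap A x))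
    {c : ℝ} (hc : c ≠ 0) : DenseRange (orbitMap A ((c : ℂ) • x)) := by
  refine Dense.mono ?_ hx
  rintro _ ⟨⟨p, q⟩, rfl⟩
  refine ⟨(c : ℂ)⁻¹ • (p, q), ?_⟩
  have hc' : (c : ℂ) ≠ 0 := by exact_mod_cast hc
  rw [map_smul, orbitMap_apply, orbitMap_apply, map_smulₛₗ A, Complex.conj_ofReal, map_smul,
    map_smul, ← smul_add, inv_smul_smul₀ hc']

theorem inner_orbitMap_self [CompleteSpace H] {A : H →L⋆[ℂ] H} {x : H} (hA : IsSelfAdjointOp A)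
    {ρ : Measure ℝ≥0} [IsFiniteMeasure ρ] {M : ℝ≥0} (hM : ∀ᵐ r ∂ρ, r ≤ M)
    (hmom : ∀ n : ℕ, inner ℂ x ((square A ^ n) x) = ((∫ r : ℝ≥0, (r : ℝ) ^ (2 * n) ∂ρ : ℝ) : ℂ))
    {s : ℝ≥0 → ℂ} (hs : Measurable s) (hsr : ∀ᵐ r ∂ρ, ‖s r‖ ≤ r)
    (hsA : ∀ p : ℂ[X],
      inner ℂ (A x) (Polynomial.aeval (square A) p x) = ∫ r, conj (s r) * evalSq p r ∂ρ)
    (p q : ℂ[X]) : inner ℂ (orbitMap A x (p, q)) (orbitMap A x (p, q)) =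
      ∫ r : ℝ≥0, (conj (evalSq p r) * evalSq p r + (r : ℂ) ^ 2 * (conj (evalSq q r) * evalSq q r) +
        (conj (s r) * conj (evalSq q r) * evalSq p r +
          s r * evalSq q r * conj (evalSq p r))) ∂ρ := by
  have hqA : Polynomial.aeval (square A) q (A x) =
      A (Polynomial.aeval (square A) (conjPoly q) x) := by
    rw [apply_aeval_square, conjPoly_conjPoly]
  have h1 := inner_aeval_aeval hA hM hmom p p
  have h2 : inner ℂ (Polynomial.aeval (square A) q (A x)) (Polynomial.aeval (square A) p x) =
      ∫ r, conj (s r) * conj (evalSq q r) * evalSq p r ∂ρ := by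
    rw [hA.inner_aeval_square, ← mul_apply_eq_comp, ← map_mul, hsA]
    simp_rw [evalSq_mul, evalSq_conjPoly, mul_assoc]
  have h3 : inner ℂ (Polynomial.aeval (square A) p x) (Polynomial.aeval (square A) q (A x)) =
      ∫ r, s r * evalSq q r * conj (evalSq p r) ∂ρ := by
    rw [← inner_conj_symm, h2, ← integral_conj]
    simp
  have h4 : inner ℂ (Polynomial.aeval (square A) q (A x)) (Polynomial.aeval (square A) q (A x)) =
      ∫ r : ℝ≥0, (r : ℂ) ^ 2 * (conj (evalSq q r) * evalSq q r) ∂ρ := by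
    rw [hqA, hA.inner_apply_comm, ← square_apply]
    have : square A (Polynomial.aeval (square A) (conjPoly q) x) =
        Polynomial.aeval (square A) (Polynomial.X * conjPoly q) x := by simp
    rw [this, inner_aeval_aeval hA hM hmom]
    refine integral_congr_ae (.of_forall fun r => ?_)
    simp only [evalSq_mul, evalSq_X, evalSq_conjPoly, map_mul, map_pow, Complex.conj_ofReal,
      Complex.conj_conj]
    ring
  obtain ⟨P, hP⟩ := exists_bound_of_continuous (continuous_evalSq p) hM
  obtain ⟨Q, hQ⟩ := exists_bound_of_continuous (continuous_evalSq q) hM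
  have hpm := (continuous_evalSq p).measurable
  have hqm := (continuous_evalSq q).measurable
  have hcm : Measurable (starRingEnd ℂ) := RCLike.continuous_conj.measurable
  have i1 : Integrable (fun r => conj (evalSq p r) * evalSq p r) ρ :=
    (memLp_of_continuous (by have := continuous_evalSq p; fun_prop) hM).integrable one_le_two
  have i4 : Integrable (fun r : ℝ≥0 => (r : ℂ) ^ 2 * (conj (evalSq q r) * evalSq q r)) ρ :=
    (memLp_of_continuous (by have := continuous_evalSq q; fun_prop) hM).integrable one_le_two
  have i3 : Integrable (fun r => s r * evalSq q r * conj (evalSq p r)) ρ := by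
    refine Integrable.of_bound ((hs.mul hqm).mul (hcm.comp hpm)).aestronglyMeasurable
      (M * Q * P) ?_
    filter_upwards [hsr, hP, hQ, hM] with r h1 h2 h3 h4
    have h5 : ‖s r‖ ≤ M := h1.trans h4
    have := (norm_nonneg _).trans h3
    rw [norm_mul, norm_mul, RCLike.norm_conj]
    gcongr
  have i2 : Integrable (fun r => conj (s r) * conj (evalSq q r) * evalSq p r) ρ := by
    have := (RCLike.conjCLE (K := ℂ)).toContinuousLinearMap.integrable_comp i3
    refine this.congr (.of_forall fun r => ?_)
    simp
  have hadd := integral_add (i1.add i4) (i2.add i3)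
  simp only [Pi.add_apply] at hadd
  rw [orbitMap_apply, inner_add_left, inner_add_right, inner_add_right, h1, h2, h3, h4, hadd,
    integral_add i1 i4, integral_add i2 i3]
  ring

end Orbit

/-! ### The isometry and the multiplication model -/

section Model

variable {ρ : Measure ℝ≥0} [IsFiniteMeasure ρ] {M : ℝ≥0}

/-- A measurable unimodular function `u` with `s = u² |s|`. -/
def halfPhase (s : ℝ≥0 → ℂ) (r : ℝ≥0) : ℂ :=
  Complex.exp ((Complex.arg (s r) / 2 : ℝ) * Complex.I)

theorem measurable_halfPhase {s : ℝ≥0 → ℂ} (hs : Measurable s) : Measurable (halfPhase s) := by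
  unfold halfPhase
  have := Complex.measurable_arg.comp hs
  exact Complex.measurable_exp.comp
    ((Complex.measurable_ofReal.comp (this.div_const 2)).mul_const _)

theorem norm_halfPhase (s : ℝ≥0 → ℂ) (r : ℝ≥0) : ‖halfPhase s r‖ = 1 :=
  Complex.norm_exp_ofReal_mul_I _

theorem halfPhase_sq_mul_norm (s : ℝ≥0 → ℂ) (r : ℝ≥0) : halfPhase s r ^ 2 * ‖s r‖ = s r := by
  conv_rhs => rw [← Complex.norm_mul_exp_arg_mul_I (s r)]
  rw [halfPhase, ← Complex.exp_nat_mul, mul_comm]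
  congr 2
  push_cast
  ring

/-- The weight `w = |s| / r`, cut off at `1` so that the bound holds everywhere and not just almost
everywhere. The value at `r = 0` is irrelevant, since there `r` and `-r` are the same point. -/
def signWeight (s : ℝ≥0 → ℂ) (r : ℝ≥0) : ℝ := min 1 (‖s r‖ / r)

theorem measurable_signWeight {s : ℝ≥0 → ℂ} (hs : Measurable s) : Measurable (signWeight s) := by
  unfold signWeight
  fun_prop

theorem signWeight_nonneg (s : ℝ≥0 → ℂ) (r : ℝ≥0) : 0 ≤ signWeight s r :=
  le_min zero_le_one (by positivity)

theorem signWeight_le_one (s : ℝ≥0 → ℂ) (r : ℝ≥0) : signWeight s r ≤ 1 := min_le_left _ _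

theorem signWeight_mul {s : ℝ≥0 → ℂ} {r : ℝ≥0} (h : ‖s r‖ ≤ r) : signWeight s r * r = ‖s r‖ := by
  rcases eq_or_ne r 0 with rfl | hr
  · have : ‖s 0‖ = 0 := le_antisymm (by simpa using h) (norm_nonneg _)
    simp [this]
  · have hr' : (0 : ℝ) < r := by positivity
    rw [signWeight, min_eq_right ((div_le_one hr').2 h), div_mul_cancel₀ _ hr'.ne']

theorem inner_phasedPolyLp_self (hM : ∀ᵐ r ∂ρ, r ≤ M) {s : ℝ≥0 → ℂ} (hs : Measurable s)
    (hsr : ∀ᵐ r ∂ρ, ‖s r‖ ≤ r)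
    (hμ : MeasurePreserving (fun z : ℂ => ‖z‖₊) (symmetricExtension ρ (signWeight s)) ρ)
    (p q : ℂ[X]) :
    inner ℂ (phasedPolyLp hM hμ (measurable_halfPhase hs) (norm_halfPhase s) (p, q))
      (phasedPolyLp hM hμ (measurable_halfPhase hs) (norm_halfPhase s) (p, q)) =
      ∫ r : ℝ≥0, (conj (evalSq p r) * evalSq p r + (r : ℂ) ^ 2 * (conj (evalSq q r) * evalSq q r) +
        (conj (s r) * conj (evalSq q r) * evalSq p r +
          s r * evalSq q r * conj (evalSq p r))) ∂ρ := by
  have hL := memLp_phasedPoly hM hμ (measurable_halfPhase hs) (norm_halfPhase s) p q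
  have h1 : phasedPolyLp hM hμ (measurable_halfPhase hs) (norm_halfPhase s) (p, q) = hL.toLp := rfl
  have hint : Integrable (fun z => conj (phasedPoly (halfPhase s) p q z) *
      phasedPoly (halfPhase s) p q z) (symmetricExtension ρ (signWeight s)) := by
    refine (L2.integrable_inner (𝕜 := ℂ) hL.toLp hL.toLp).congr ?_
    filter_upwards [hL.coeFn_toLp] with z hz
    rw [hz, RCLike.inner_apply, mul_comm]
  rw [h1, inner_toLp, integral_symmetricExtension (measurable_signWeight hs) (signWeight_nonneg s)
    (signWeight_le_one s) hint]
  refine integral_congr_ae ?_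
  filter_upwards [hsr] with r hr
  have hw : (signWeight s r : ℂ) * r = ‖s r‖ := by
    have := signWeight_mul hr
    exact_mod_cast this
  have hu : conj (halfPhase s r) * halfPhase s r = 1 := by
    rw [Complex.conj_mul', norm_halfPhase]
    simp
  have hsu := halfPhase_sq_mul_norm s r
  have hsu' := congrArg conj hsu
  have hn : ‖(r : ℂ)‖₊ = r := by ext; simp
  simp only [map_mul, map_pow, Complex.conj_ofReal] at hsu'
  simp only [phasedPoly, nnnorm_neg, hn, map_add, map_mul, map_neg, Complex.conj_conj,
    Complex.conj_ofReal]
  generalize halfPhase s r = u at *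
  generalize conj u = u' at *
  generalize conj (evalSq p r) = a' at *
  generalize conj (evalSq q r) = b' at *
  generalize evalSq p r = a at *
  generalize evalSq q r = b at *
  -- The cross terms at `r` and `-r` have opposite signs, so their weights leave `w r u² = s`.
  linear_combination (a' * a + (r : ℂ) ^ 2 * (b' * b)) * hu +
    (u ^ 2 * a' * b + u' ^ 2 * a * b') * hw + a' * b * hsu + a * b' * hsu'

end Model

theorem continuous_mul_conj {μ : Measure ℂ} {C : ℝ≥0}
    (hB : ∀ f : Lp ℂ 2 μ, MemLp (fun z => z * conj (f z)) 2 μ) (hC : ∀ᵐ z ∂μ, ‖z‖ ≤ C) :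
    Continuous fun f => (hB f).toLp := by
  refine (LipschitzWith.of_dist_le_mul (K := C) fun f g => ?_).continuous
  rw [dist_eq_norm, dist_eq_norm]
  refine Lp.norm_le_mul_norm_of_ae_le_mul ?_
  filter_upwards [Lp.coeFn_sub (hB f).toLp (hB g).toLp, (hB f).coeFn_toLp, (hB g).coeFn_toLp,
    Lp.coeFn_sub f g, hC] with z h1 h2 h3 h4 h5
  rw [h1, Pi.sub_apply, h2, h3, h4, Pi.sub_apply, ← mul_sub, ← map_sub, norm_mul, RCLike.norm_conj]
  gcongr

/-- The theorem for a unit vector `x` whose vectors `p(T) x + q(T) A x` are dense in `H`. -/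
theorem exists_multiplication_model {H : Type*} [NormedAddCommGroup H] [InnerProductSpace ℂ H]
    [CompleteSpace H] {A : H →L⋆[ℂ] H} (hA : IsSelfAdjointOp A) {x : H} (hx : ‖x‖ = 1)
    (hdense : DenseRange (orbitMap A x)) :
    ∃ μ : Measure ℂ, IsSymmetricBiradial μ ∧ IsCompact μ.support ∧
      ∃ U : H ≃ₗᵢ[ℂ] Lp ℂ 2 μ, ∀ f : Lp ℂ 2 μ,
        (U (A (U.symm f)) : ℂ → ℂ) =ᵐ[μ] fun z => z * conj ((f : ℂ → ℂ) z) := by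
  obtain ⟨ρ, M, hρ, hM, hmom⟩ := exists_moment_measure (square A) hA.isPositive_square x
  have hprob : IsProbabilityMeasure ρ := by
    have h0 := hmom 0
    rw [pow_zero, one_apply_eq_self, inner_self_eq_norm_sq_to_K, hx] at h0
    simp only [mul_zero, pow_zero, integral_const, smul_eq_mul, mul_one] at h0
    refine ⟨?_⟩
    have h1 : ρ.real Set.univ = 1 := by
      have h2 : ((ρ.real Set.univ : ℝ) : ℂ) = ((1 : ℝ) : ℂ) := by simpa using h0.symm
      exact_mod_cast h2
    rw [← ENNReal.toReal_eq_one_iff]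
    exact h1
  obtain ⟨s, hs, hsr, hsA⟩ := exists_cross_density hA hM hmom
  have hw := measurable_signWeight hs
  have hw0 := signWeight_nonneg s
  have hw1 := signWeight_le_one s
  set μ := symmetricExtension ρ (signWeight s) with hμdef
  have hμ : MeasurePreserving (fun z : ℂ => ‖z‖₊) μ ρ :=
    measurePreserving_nnnorm_symmetricExtension hw hw0 hw1
  have hμM := ae_norm_le hM hμ
  refine ⟨μ, isSymmetricBiradial_symmetricExtension hw hw0 hw1, ?_, ?_⟩
  · refine (isCompact_closedBall (0 : ℂ) M).of_isClosed_subset Measure.isClosed_support ?_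
    refine Measure.support_subset_of_isClosed Metric.isClosed_closedBall ?_
    filter_upwards [hμM] with z hz
    simpa using hz
  let Q := phasedPolyLp hM hμ (measurable_halfPhase hs) (norm_halfPhase s)
  have hQ : DenseRange Q := denseRange_phasedPolyLp hM hμ _ _ ae_im_eq_zero_symmetricExtension
  have hnorm : ∀ e, ‖Q (LinearEquiv.refl ℂ _ e)‖ = ‖orbitMap A x e‖ := by
    rintro ⟨p, q⟩
    rw [@norm_eq_sqrt_re_inner ℂ, @norm_eq_sqrt_re_inner ℂ,
      inner_orbitMap_self hA hM hmom hs hsr hsA p q]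
    congr 2
    exact inner_phasedPolyLp_self hM hs hsr hμ p q
  let U : H ≃ₗᵢ[ℂ] Lp ℂ 2 μ :=
    (LinearEquiv.refl ℂ (ℂ[X] × ℂ[X])).extendOfIsometry (orbitMap A x) Q hdense hQ hnorm
  have hU : ∀ e, U (orbitMap A x e) = Q e :=
    LinearEquiv.extendOfIsometry_eq _ _ _ hdense hQ hnorm
  have hB : ∀ f : Lp ℂ 2 μ, MemLp (fun z => z * conj (f z)) 2 μ := fun f => by
    refine (Lp.memLp f).of_le_mul (c := M) (measurable_id.aestronglyMeasurable.mul
      (RCLike.continuous_conj.comp_aestronglyMeasurable (Lp.aestronglyMeasurable f))) ?_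
    filter_upwards [hμM] with z hz
    rw [norm_mul, RCLike.norm_conj]
    gcongr
  have key : ∀ v, U (A v) = (hB (U v)).toLp := by
    intro v
    refine hdense.induction_on v (isClosed_eq (by fun_prop)
      ((continuous_mul_conj hB hμM).comp U.continuous)) ?_
    rintro ⟨p, q⟩
    rw [apply_orbitMap, hU]
    refine Lp.ext ?_
    filter_upwards [(hB (U (orbitMap A x (p, q)))).coeFn_toLp,
      (memLp_phasedPoly hM hμ (measurable_halfPhase hs) (norm_halfPhase s) p q).coeFn_toLp,
      (memLp_phasedPoly hM hμ (measurable_halfPhase hs) (norm_halfPhase s)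
        (Polynomial.X * conjPoly q) (conjPoly p)).coeFn_toLp] with z h1 h2 h3
    rw [h1, hU]
    refine h3.trans ?_
    rw [phasedPoly_conj, ← h2]
    rfl
  refine ⟨U, fun f => ?_⟩
  rw [key]
  refine (hB _).coeFn_toLp.trans ?_
  rw [U.apply_symm_apply]

end Antilinear

end

theorem theorem3p4 {H : Type*} [NormedAddCommGroup H] [InnerProductSpace ℂ H] [CompleteSpace H]
    [Nontrivial H] (A : H →L⋆[ℂ] H) (hA : Antilinear.IsSelfAdjointOp A)
    (hcyc : ∃ x : H, Antilinear.IsCyclicVector A x) :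
    ∃ μ : Measure ℂ, Antilinear.IsSymmetricBiradial μ ∧ IsCompact μ.support ∧
      ∃ U : H ≃ₗᵢ[ℂ] Lp ℂ 2 μ, ∀ f : Lp ℂ 2 μ,
        (U (A (U.symm f)) : ℂ → ℂ) =ᵐ[μ] fun z => z * conj ((f : ℂ → ℂ) z) := by
  obtain ⟨x, hx⟩ := hcyc
  have hdense := Antilinear.denseRange_orbitMap hx
  have hx0 : x ≠ 0 := by
    rintro rfl
    obtain ⟨v, hv⟩ := exists_ne (0 : H)
    refine hv ?_
    refine hdense.induction_on v (isClosed_eq continuous_id continuous_const) ?_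
    rintro ⟨p, q⟩
    simp [Antilinear.orbitMap_apply]
  have hn : ‖x‖ ≠ 0 := norm_ne_zero_iff.2 hx0
  refine Antilinear.exists_multiplication_model hA (x := ((‖x‖⁻¹ : ℝ) : ℂ) • x) ?_
    (Antilinear.denseRange_orbitMap_smul hdense (inv_ne_zero hn))
  rw [norm_smul, Complex.norm_real, norm_inv, norm_norm, inv_mul_cancel₀ hn]
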